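/- **Setting.** Let $\Phi=\{p_1,p_2,\dots\}$ be a countably infinite set of (real) primitive propositions and $\Phi'=\{q_1,q_2,\dots\}$ a disjoint countably infinite set of shadow propositions; put $\Phi^+=\Phi\cup\Phi'$. Formulas of the static language $\mathcal L^{\forall,X,\ell,A}_n$ (with $n$ agents) over a set of primitive propositions are built from these propositions and countably many variables by $\neg$, $\wedge$, $A_i$ (awareness), $X_i$ (explicit knowledge), likelihood formulas $a_1\ell_i(\varphi_1)+\dots+a_k\ell_i(\varphi_k)>b$ ($k\ge 1$, $a_j,b\in\mathbb Q$), and $\forall x$; $\exists x\,\varphi$ abbreviates $\neg\forall x\,\neg\varphi$. Write $\mathrm{prop}(\varphi)$ for the set of primitive propositions occurring in $\varphi$. A probabilistic awareness structure $M=(S,\pi,(\mathcal K_i),(\mathcal A_i),(\mathcal{PR}_i),\mathcal L)$ consists of a finite set $S$ of states; a valuation $\pi$ of $\Phi^+$ at each state; for each agent $i$ a Euclidean, transitive, serial relation $\mathcal K_i$ on $S$; sets $\mathcal A_i(s)\subseteq\mathcal L(s)\subseteq\Phi^+$ (what $i$ is aware of at $s$, and the language of $s$); and a probability $\mathcal{PR}_i(s)$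 on $\mathcal K_i(s)=\{s':(s,s')\in\mathcal K_i\}$; such that whenever $s'\in\mathcal K_i(s)$ we have $\mathcal{PR}_i(s')=\mathcal{PR}_i(s)$, $\mathcal A_i(s')=\mathcal A_i(s)$ and $\mathcal L(s')\subseteq\mathcal A_i(s)\cup\Phi'$. Truth at $(M,s)$ is defined as follows: - $p$ holds iff $p\in\mathcal L(s)$ and $\pi(s,p)$ is true; - $\neg\varphi$ holds iff $\mathrm{prop}(\varphi)\subseteq\mathcal L(s)$ and $\varphi$ does not hold; - $\varphi\wedge\psi$ holds iff both do; - $A_i\varphi$ holds iff $\mathrm{prop}(\varphi)\subseteq\mathcal A_i(s)$; - $X_i\varphi$ holds iff $A_i\varphi$ does and $\varphi$ holds at all $s'\in\mathcal K_i(s)$; - $\forall x\,\varphi$ holds iff $\varphi[x/\psi]$ does for every quantifier-free sentence $\psi$ with $\mathrm{prop}(\psi)\subseteq\mathcal L(s)$; - $a_1\ell_i(\varphi_1)+\dots+a_k\ell_i(\varphi_k)>b$ holds iff $\sum_j a_j\,\mathcal{PR}_i(s)(\{s'\in\mathcal K_i(s):(M,s')\models\varphi_j\})>b$ and $\bigcup_j\mathrm{prop}(\varphi_j)\subseteq\mathcal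 A_i(s)$. (By convention, a free variable counts as false; this does not affect sentences.) For a formula $\varphi$ and an agent $i$, $\mathit{Consis}(\varphi,i)$ is true at $(M,t)$ iff $t$ is consistent with $i$ becoming aware of $\varphi$, i.e. the number of shadow propositions in $\mathcal L(t)\setminus\mathcal A_i(t)$ is at least the number of propositions in $\mathrm{prop}(\varphi)\setminus\mathcal A_i(t)$. **Statement.** Let $\varphi$ be a formula over $\Phi$ and let $i$ be one of the $n$ agents. 1. If $\mathrm{prop}(\varphi)=\emptyset$, then $\mathit{Consis}(\varphi,i)$ is equivalent to $\mathit{true}$: it holds at every state of every structure. 2. If $|\mathrm{prop}(\varphi)|=1$, then $\mathit{Consis}(\varphi,i)$ is equivalent to $\exists x\,\neg A_i(x)$ at all states that $i$ considers possible when unaware of $\varphi$: for every structure $M$ and all states $s,t$ with $t\in\mathcal K_i(s)$ and $\mathrm{prop}(\varphi)\not\subseteq\mathcal A_i(s)$, we have $(M,t)\models\mathit{Consis}(\varphi,i)$ iff $(M,t)\models\exists x\,\neg A_i(x)$. 3. If $|\mathrm{prop}(\varphi)|>1$, then $\mathit{Consis}(\varphi,i)$ is not equivalent to any formula $\chi$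 of $\mathcal L^{\forall,X,\ell,A}_n$ over $\Phi^+$ (in particular, to none over $\Phi$), even at such states: for every $\chi$ there are a structure $M$ and states $s,t$ with $\mathrm{prop}(\varphi)\subseteq\mathcal L(s)$, $\mathrm{prop}(\varphi)\not\subseteq\mathcal A_i(s)$ and $t\in\mathcal K_i(s)$ such that exactly one of $\mathit{Consis}(\varphi,i)$ and $\chi$ is true at $(M,t)$. -/

import Mathlib

namespace Awareness

/-- Primitive propositions `Φ⁺ = Φ ∪ Φ'`: `real k` is the `k`-th element of the countably infinite
set `Φ`, `shadow k` the `k`-th element of the countably infinite set `Φ'`, disjoint from `Φ`. -/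
inductive Atom : Type
  | real (k : ℕ)
  | shadow (k : ℕ)
  deriving DecidableEq

/-- The set `Φ` of real propositions. -/
def realAtoms : Set Atom := Set.range Atom.real

/-- The set `Φ'` of shadow propositions. -/
def shadowAtoms : Set Atom := Set.range Atom.shadow

/-- Formulas of the static language with `n` agents over `Φ⁺`; variables are natural numbers.
`lik i k a φ b` is the likelihood formula `a₀ ℓᵢ(φ₀) + ⋯ + aₖ ℓᵢ(φₖ) > b` (so it has at least
one summand). -/
inductive Formula (n : ℕ) : Type
  | atom (p : Atom)
  | var (x : ℕ)
  | neg (φ : Formula n)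
  | conj (φ ψ : Formula n)
  | aware (i : Fin n) (φ : Formula n)
  | know (i : Fin n) (φ : Formula n)
  | lik (i : Fin n) (k : ℕ) (a : Fin (k + 1) → ℚ) (φ : Fin (k + 1) → Formula n) (b : ℚ)
  | all (x : ℕ) (φ : Formula n)

namespace Formula

variable {n : ℕ}

/-- `∃ x φ` abbreviates `¬ ∀ x ¬ φ`. -/
def ex (x : ℕ) (φ : Formula n) : Formula n := neg (all x (neg φ))

/-- The set of primitive propositions occurring in a formula. -/
def prop : Formula n → Finset Atom
  | atom p => {p}
  | var _ => ∅
  | neg φ => φ.prop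
  | conj φ ψ => φ.prop ∪ ψ.prop
  | aware _ φ => φ.prop
  | know _ φ => φ.prop
  | lik _ _ _ φ _ => Finset.univ.biUnion fun j => (φ j).prop
  | all _ φ => φ.prop

/-- The set of free variables of a formula. -/
def freeVars : Formula n → Finset ℕ
  | atom _ => ∅
  | var x => {x}
  | neg φ => φ.freeVars
  | conj φ ψ => φ.freeVars ∪ ψ.freeVars
  | aware _ φ => φ.freeVars
  | know _ φ => φ.freeVars
  | lik _ _ _ φ _ => Finset.univ.biUnion fun j => (φ j).freeVars
  | all x φ => φ.freeVars.erase x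

/-- A sentence is a formula without free variables. -/
def IsSentence (φ : Formula n) : Prop := φ.freeVars = ∅

/-- The formula contains no quantifier. -/
def QuantifierFree : Formula n → Prop
  | atom _ => True
  | var _ => True
  | neg φ => φ.QuantifierFree
  | conj φ ψ => φ.QuantifierFree ∧ ψ.QuantifierFree
  | aware _ φ => φ.QuantifierFree
  | know _ φ => φ.QuantifierFree
  | lik _ _ _ φ _ => ∀ j, (φ j).QuantifierFree
  | all _ _ => False

/-- `subst x ψ φ` is `φ[x/ψ]`: every free occurrence of `x` in `φ` is replaced by `ψ`.
It is used only for sentences `ψ`, so no variable can be captured. -/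
def subst (x : ℕ) (ψ : Formula n) : Formula n → Formula n
  | atom p => atom p
  | var y => if y = x then ψ else var y
  | neg φ => neg (subst x ψ φ)
  | conj φ χ => conj (subst x ψ φ) (subst x ψ χ)
  | aware i φ => aware i (subst x ψ φ)
  | know i φ => know i (subst x ψ φ)
  | lik i k a φ b => lik i k a (fun j => subst x ψ (φ j)) b
  | all y φ => if y = x then all y φ else all y (subst x ψ φ)

/-- Nesting depth of quantifiers (used only to see that the truth definition terminates). -/
def qdepth : Formula n → ℕ
  | atom _ => 0
  | var _ => 0
  | neg φ => φ.qdepth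
  | conj φ ψ => max φ.qdepth ψ.qdepth
  | aware _ φ => φ.qdepth
  | know _ φ => φ.qdepth
  | lik _ _ _ φ _ => Finset.univ.sup fun j => (φ j).qdepth
  | all _ φ => φ.qdepth + 1

/-- Nesting depth of all constructors (used only to see that the truth definition terminates). -/
def depth : Formula n → ℕ
  | atom _ => 0
  | var _ => 0
  | neg φ => φ.depth + 1
  | conj φ ψ => max φ.depth ψ.depth + 1
  | aware _ φ => φ.depth + 1
  | know _ φ => φ.depth + 1
  | lik _ _ _ φ _ => (Finset.univ.sup fun j => (φ j).depth) + 1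
  | all _ φ => φ.depth + 1

theorem QuantifierFree.qdepth_eq_zero {ψ : Formula n} (h : ψ.QuantifierFree) : ψ.qdepth = 0 := by
  induction ψ with
  | atom p => rfl
  | var x => rfl
  | neg φ ih => exact ih h
  | conj φ χ ih₁ ih₂ => simp [qdepth, ih₁ h.1, ih₂ h.2]
  | aware i φ ih => exact ih h
  | know i φ ih => exact ih h
  | lik i k a φ b ih =>
    simp only [qdepth]
    exact Nat.le_zero.1 (Finset.sup_le fun j _ => (ih j (h j)).le)
  | all x φ ih => exact h.elim

theorem qdepth_subst_le {ψ : Formula n} (h : ψ.QuantifierFree) (x : ℕ) (φ : Formula n) :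
    (subst x ψ φ).qdepth ≤ φ.qdepth := by
  induction φ with
  | atom p => exact le_rfl
  | var y =>
    simp only [subst]
    split_ifs
    · exact h.qdepth_eq_zero.le
    · exact le_rfl
  | neg φ ih => exact ih
  | conj φ χ ih₁ ih₂ => exact max_le_max ih₁ ih₂
  | aware i φ ih => exact ih
  | know i φ ih => exact ih
  | lik i k a φ b ih => exact Finset.sup_mono_fun fun j _ => ih j
  | all y φ ih =>
    simp only [subst]
    split_ifs
    · exact le_rfl
    · exact Nat.succ_le_succ ih

end Formula

/-- Probabilistic awareness structures for `n` agents over `Φ⁺` with finite set of states `S`.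
`PR i s` is a probability on (all subsets of) `Kᵢ(s)`, given as a probability mass function on `S`
supported in `Kᵢ(s)`. -/
structure AwarenessStructure (n : ℕ) (S : Type) [Finite S] where
  /-- truth values of the primitive propositions at the states -/
  val : S → Atom → Prop
  /-- `K i s s'`: at `s`, agent `i` considers `s'` possible -/
  K : Fin n → S → S → Prop
  /-- the primitive propositions that agent `i` is aware of at a state -/
  A : Fin n → S → Set Atom
  /-- the probability of agent `i` at a state -/
  PR : Fin n → S → PMF S
  /-- the language (a set of primitive propositions) of a state -/
  L : S → Set Atom
  euclidean : ∀ i s₁ s₂ s₃, K i s₁ s₂ → K i s₁ s₃ → K i s₂ s₃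
  transitive : ∀ i s₁ s₂ s₃, K i s₁ s₂ → K i s₂ s₃ → K i s₁ s₃
  serial : ∀ i s, ∃ s', K i s s'
  PR_support : ∀ i s, (PR i s).support ⊆ {s' | K i s s'}
  PR_const : ∀ i s s', K i s s' → PR i s' = PR i s
  A_const : ∀ i s s', K i s s' → A i s = A i s'
  A_subset_L : ∀ i s, A i s ⊆ L s
  L_subset : ∀ i s s', K i s s' → L s' ⊆ A i s ∪ shadowAtoms

namespace AwarenessStructure

open Formula

variable {n : ℕ} {S : Type} [Finite S]

/-- `M.Sat φ s` is `(M, s) ⊨ φ`. Quantifiers range over the quantifier-free sentences of the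
language of the state. (Truth is meant for sentences; a free variable counts as false.) -/
def Sat (M : AwarenessStructure n S) : Formula n → S → Prop
  | atom p, s => p ∈ M.L s ∧ M.val s p
  | var _, _ => False
  | neg φ, s => (φ.prop : Set Atom) ⊆ M.L s ∧ ¬ M.Sat φ s
  | conj φ ψ, s => M.Sat φ s ∧ M.Sat ψ s
  | aware i φ, s => (φ.prop : Set Atom) ⊆ M.A i s
  | know i φ, s => (φ.prop : Set Atom) ⊆ M.A i s ∧ ∀ s', M.K i s s' → M.Sat φ s'
  | lik i _ a φ b, s =>
      (∑ j, (a j : ℝ) *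
        ((M.PR i s).toOuterMeasure ({s' | M.Sat (φ j) s'} ∩ {s' | M.K i s s'})).toReal) > (b : ℝ) ∧
      ∀ j, ((φ j).prop : Set Atom) ⊆ M.A i s
  | all x φ, s => ∀ ψ : Formula n, ∀ _ : ψ.QuantifierFree, ψ.IsSentence →
      (ψ.prop : Set Atom) ⊆ M.L s → M.Sat (subst x ψ φ) s
termination_by φ => (φ.qdepth, φ.depth)
decreasing_by
  · exact Prod.Lex.right _ (Nat.lt_succ_self _)
  · exact Prod.lex_def.2 ((le_max_left φ.qdepth ψ.qdepth).lt_or_eq.imp id fun h =>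
      ⟨h, Nat.lt_succ_of_le (le_max_left _ _)⟩)
  · exact Prod.lex_def.2 ((le_max_right φ.qdepth ψ.qdepth).lt_or_eq.imp id fun h =>
      ⟨h, Nat.lt_succ_of_le (le_max_right _ _)⟩)
  · exact Prod.Lex.right _ (Nat.lt_succ_self _)
  · exact Prod.lex_def.2
      ((Finset.le_sup (f := fun j => (φ j).qdepth) (Finset.mem_univ j)).lt_or_eq.imp id fun h =>
        ⟨h, Nat.lt_succ_of_le (Finset.le_sup (f := fun j => (φ j).depth) (Finset.mem_univ j))⟩)
  · exact Prod.Lex.left _ _ (Nat.lt_succ_of_le (qdepth_subst_le (by assumption) _ _))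

/-- `M.Consis φ i t`: the state `t` is consistent with `i` becoming aware of `φ`, that is, `L(t)`
contains at least as many shadow propositions that `i` is unaware of (at `t`) as there are
primitive propositions in `φ` that `i` is unaware of. -/
def Consis (M : AwarenessStructure n S) (φ : Formula n) (i : Fin n) (t : S) : Prop :=
  ((φ.prop : Set Atom) \ M.A i t).encard ≤ ((M.L t ∩ shadowAtoms) \ M.A i t).encard

end AwarenessStructure

end Awareness

/-! With no propositions, `Consis` compares `0` with a cardinality. With one, `Consis` asks for a
shadow proposition in the language of `t` outside the agent's awareness; any such unaware
proposition is shadow by `L_subset`, so this is `¬ L t ⊆ A i t`, which `∃ x ¬ A_i(x)` expresses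
(`consis_iff_of_card_eq_one`, `sat_ex_not_aware`). With more, the point is that formulas cannot
count unaware propositions. Take two structures whose only possible state has as its language `m =
|prop φ|` shadow propositions, respectively one, all fresh for `χ` and all true, with nobody aware
of anything. Collapsing the `m` propositions to the one preserves truth (`twoState_sat_rename`) and
fixes `χ`, but `Consis` holds only in the first. -/

namespace Awareness

namespace Formula

variable {n : ℕ}

/-- Rename the primitive propositions of a formula along `r`. -/
def rename (r : Atom → Atom) : Formula n → Formula n
  | atom p => atom (r p)
  | var x => var x
  | neg φ => neg (rename r φ)
  | conj φ ψ => conj (rename r φ) (rename r ψ)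
  | aware i φ => aware i (rename r φ)
  | know i φ => know i (rename r φ)
  | lik i k a φ b => lik i k a (fun j => rename r (φ j)) b
  | all x φ => all x (rename r φ)

theorem prop_rename (r : Atom → Atom) (φ : Formula n) :
    (rename r φ).prop = φ.prop.image r := by
  induction φ with
  | lik i k a φ b ih => simp [rename, prop, ih, Finset.biUnion_image]
  | _ => simp_all [rename, prop, Finset.image_union]

theorem freeVars_rename (r : Atom → Atom) (φ : Formula n) :
    (rename r φ).freeVars = φ.freeVars := by
  induction φ <;> simp_all [rename, freeVars]

theorem quantifierFree_rename (r : Atom → Atom) (φ : Formula n) :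
    (rename r φ).QuantifierFree ↔ φ.QuantifierFree := by
  induction φ <;> simp_all [rename, QuantifierFree]

theorem rename_subst (r : Atom → Atom) (x : ℕ) (ψ φ : Formula n) :
    rename r (subst x ψ φ) = subst x (rename r ψ) (rename r φ) := by
  induction φ with
  | var y => simp only [subst, rename]; split_ifs <;> rfl
  | all y φ ih => simp only [subst, rename]; split_ifs <;> simp [rename, ih]
  | _ => simp_all [subst, rename]

theorem rename_eq_self {r : Atom → Atom} {φ : Formula n} (h : ∀ p ∈ φ.prop, r p = p) :
    rename r φ = φ := by
  induction φ with
  | lik i k a φ b ih =>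
    simp only [rename]
    congr 1
    funext j
    exact ih j fun p hp => h p (Finset.mem_biUnion.2 ⟨j, Finset.mem_univ j, hp⟩)
  | _ => simp_all [rename, prop]

end Formula

namespace AwarenessStructure

open Formula

variable {n : ℕ}

/-- The structure with two states in which every agent considers only the state `true` possible and
is aware of nothing; the languages of `false` and `true` are `P` and `Q`. -/
noncomputable def twoState (n : ℕ) (P Q : Set Atom) (hQ : Q ⊆ shadowAtoms) :
    AwarenessStructure n Bool where
  val _ _ := True
  K _ _ s' := s' = true
  A _ _ := ∅
  PR _ _ := PMF.pure true
  -- `false` serves only as the state `s` whose language contains `prop φ`; with empty awareness,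
  -- `L_subset` forces `Q` to be shadow.
  L s := if s = true then Q else P
  euclidean _ _ _ _ _ h := h
  transitive _ _ _ _ _ h := h
  serial _ _ := ⟨true, rfl⟩
  PR_support _ _ := by simp
  PR_const _ _ _ _ := rfl
  A_const _ _ _ _ := rfl
  A_subset_L _ _ := Set.empty_subset _
  L_subset _ _ s' h := by
    subst h
    simpa using hQ

variable {P Q R : Set Atom} {hQ : Q ⊆ shadowAtoms} {hR : R ⊆ shadowAtoms} {r : Atom → Atom}

theorem twoState_prop_rename_subset_L (hr : ∀ p, r p ∈ R ↔ p ∈ Q) (φ : Formula n) :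
    ((rename r φ).prop : Set Atom) ⊆ (twoState n P R hR).L true ↔
      (φ.prop : Set Atom) ⊆ (twoState n P Q hQ).L true := by
  simp [twoState, prop_rename, Set.subset_def, hr]

theorem twoState_prop_rename_subset_A (φ : Formula n) (i : Fin n) (s : Bool) :
    ((rename r φ).prop : Set Atom) ⊆ (twoState n P R hR).A i s ↔
      (φ.prop : Set Atom) ⊆ (twoState n P Q hQ).A i s := by
  simp [twoState, prop_rename]

/-- The map `r` need not be injective: all atoms of the language are true and no agent is aware of
any, so merging them is invisible. -/
theorem twoState_sat_rename (hr : ∀ p, r p ∈ R ↔ p ∈ Q) (hfix : ∀ p ∈ R, r p = p)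
    (φ : Formula n) :
    (twoState n P R hR).Sat (rename r φ) true ↔ (twoState n P Q hQ).Sat φ true := by
  suffices H : ∀ s, s = true →
      ((twoState n P R hR).Sat (rename r φ) s ↔ (twoState n P Q hQ).Sat φ s) from H true rfl
  intro s
  -- Induction along the recursion of `Sat`, since the quantifier case needs substitution instances,
  -- not subformulas.
  induction φ, s using Sat.induct with
  | case1 p s => rintro rfl; simp [Sat, rename, twoState, hr]
  | case2 x s => rintro rfl; simp [Sat, rename]
  | case3 φ s ih =>
    rintro rfl
    simp only [Sat, rename, ih rfl, twoState_prop_rename_subset_L (hQ := hQ) (hR := hR) hr]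
  | case4 φ ψ s ih₁ ih₂ =>
    rintro rfl
    simp only [Sat, rename, ih₁ rfl, ih₂ rfl]
  | case5 i φ s =>
    rintro rfl
    simp only [Sat, rename, twoState_prop_rename_subset_A (hQ := hQ) (hR := hR)]
  | case6 i φ s ih =>
    rintro rfl
    simp only [Sat, rename, twoState_prop_rename_subset_A (hQ := hQ) (hR := hR)]
    exact and_congr_right' (forall_congr' fun s' => imp_congr_right fun hs => ih s' hs)
  | case7 i k a φ b s ih =>
    rintro rfl
    simp only [Sat, rename, twoState_prop_rename_subset_A (hQ := hQ) (hR := hR)]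
    have hset : ∀ j, {s' | (twoState n P R hR).Sat (rename r (φ j)) s'} ∩
          {s' | (twoState n P R hR).K i true s'} =
        {s' | (twoState n P Q hQ).Sat (φ j) s'} ∩ {s' | (twoState n P Q hQ).K i true s'} :=
      fun j => Set.ext fun s' => and_congr_left fun hs => ih j s' hs
    simp only [hset]
    rfl
  | case8 x φ s ih =>
    rintro rfl
    simp only [Sat, rename]
    constructor
    · intro h ψ hψ hs hL
      rw [← ih ψ hψ rfl, rename_subst]
      exact h _ ((quantifierFree_rename r ψ).2 hψ) ((freeVars_rename r ψ).trans hs)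
        ((twoState_prop_rename_subset_L hr ψ).2 hL)
    · intro h ψ hψ hs hL
      -- Every instance over `R` must come from one over `Q`; as `r` fixes `R`, it is its own
      -- preimage.
      have hψr : rename r ψ = ψ :=
        rename_eq_self fun p hp => hfix p (by simpa [twoState] using hL hp)
      have := h ψ hψ hs ((twoState_prop_rename_subset_L (hR := hR) hr ψ).1 (hψr.symm ▸ hL))
      rwa [← ih ψ hψ rfl, rename_subst, hψr] at this

theorem twoState_consis (φ : Formula n) (i : Fin n) :
    (twoState n P Q hQ).Consis φ i true ↔ (φ.prop.card : ℕ∞) ≤ Q.encard := by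
  simp [Consis, twoState, Set.inter_eq_left.2 hQ]

theorem sat_ex_not_aware {S : Type} [Finite S] (M : AwarenessStructure n S) (i : Fin n) (t : S)
    (x : ℕ) : M.Sat (ex x (.neg (.aware i (.var x)))) t ↔ ¬ M.L t ⊆ M.A i t := by
  simp only [ex, Sat, subst, prop, if_true, Finset.coe_empty, Set.empty_subset, true_and]
  refine not_congr ⟨fun h p hp => ?_, fun h ψ _ _ hL => ⟨hL, fun h' => h'.2 (hL.trans h)⟩⟩
  by_contra hA
  -- Atoms suffice as instances: an unaware `p` in the language is itself a witness.
  exact (h (atom p) trivial rfl (by simpa [prop] using hp)).2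
    ⟨by simpa [prop] using hp, by simpa [prop] using hA⟩

theorem consis_iff_of_card_eq_one {S : Type} [Finite S] (M : AwarenessStructure n S)
    {φ : Formula n} (hφ : φ.prop.card = 1) {i : Fin n} {s t : S}
    (hA : ¬ (φ.prop : Set Atom) ⊆ M.A i s) (hK : M.K i s t) :
    M.Consis φ i t ↔ ¬ M.L t ⊆ M.A i t := by
  obtain ⟨p, hp⟩ := Finset.card_eq_one.1 hφ
  have hpA : p ∉ M.A i t := by simpa [hp, M.A_const i s t hK] using hA
  have hdiff : ((φ.prop : Set Atom) \ M.A i t) = {p} := by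
    rw [hp, Finset.coe_singleton]
    exact sdiff_eq_left.2 (Set.disjoint_singleton_left.2 hpA)
  rw [Consis, hdiff, Set.encard_singleton, Set.one_le_encard_iff_nonempty, Set.not_subset]
  refine ⟨fun ⟨q, hq, hqA⟩ => ⟨q, hq.1, hqA⟩, fun ⟨q, hq, hqA⟩ => ⟨q, ⟨hq, ?_⟩, hqA⟩⟩
  exact (M.L_subset i s t hK hq).resolve_left (M.A_const i s t hK ▸ hqA)

theorem exists_shadow_notMem (F : Finset Atom) : ∃ N, ∀ k, N ≤ k → Atom.shadow k ∉ F := by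
  have hinj : Function.Injective Atom.shadow := fun _ _ h => Atom.shadow.inj h
  obtain ⟨N, hN⟩ := (F.finite_toSet.preimage hinj.injOn).bddAbove
  exact ⟨N + 1, fun k hk hF => absurd (hN hF) (by omega)⟩

/-- No formula is equivalent to `Consis φ i` if `φ` has at least two primitive propositions. -/
theorem not_exists_consis_iff_sat (i : Fin n) {φ : Formula n} (hφ : 1 < φ.prop.card) :
    ¬ ∃ χ : Formula n, ∀ (S : Type) [Finite S] (M : AwarenessStructure n S) (s t : S),
      (φ.prop : Set Atom) ⊆ M.L s → ¬ (φ.prop : Set Atom) ⊆ M.A i s → M.K i s t →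
      (M.Consis φ i t ↔ M.Sat χ t) := by
  classical
  rintro ⟨χ, hχ⟩
  have hinj : Function.Injective Atom.shadow := fun _ _ h => Atom.shadow.inj h
  obtain ⟨N, hN⟩ := exists_shadow_notMem χ.prop
  -- Exactly `|prop φ|` propositions, just enough for `Consis`; starting at `N` keeps them out of
  -- `χ`.
  let Q : Set Atom := Atom.shadow '' (Finset.Ico N (N + φ.prop.card) : Finset ℕ)
  have hQ : Q ⊆ shadowAtoms := Set.image_subset_range _ _
  have hR : {Atom.shadow N} ⊆ shadowAtoms := Set.singleton_subset_iff.2 ⟨N, rfl⟩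
  have hNQ : Atom.shadow N ∈ Q := ⟨N, by simpa using Nat.zero_lt_of_lt hφ, rfl⟩
  have hQχ : ∀ p ∈ χ.prop, p ∉ Q := by
    rintro _ hp ⟨k, hk, rfl⟩
    exact hN k (Finset.mem_Ico.1 (Finset.mem_coe.1 hk)).1 hp
  have hcard : Q.encard = φ.prop.card := by
    rw [hinj.encard_image, Set.encard_coe_eq_coe_finsetCard, Nat.card_Ico, Nat.add_sub_cancel_left]
  let r : Atom → Atom := fun p => if p ∈ Q then Atom.shadow N else p
  have hr : ∀ p, r p ∈ ({Atom.shadow N} : Set Atom) ↔ p ∈ Q := by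
    intro p
    by_cases hp : p ∈ Q
    · simp [r, hp]
    · simpa [r, hp] using fun h : p = _ => hp (h ▸ hNQ)
  have hfix : ∀ p ∈ ({Atom.shadow N} : Set Atom), r p = p := by
    rintro _ rfl
    exact if_pos hNQ
  have hne : ¬ (φ.prop : Set Atom) ⊆ ∅ := by
    rw [Set.subset_empty_iff, Finset.coe_eq_empty, ← Finset.card_eq_zero]
    omega
  have key := twoState_sat_rename (P := φ.prop) (hQ := hQ) (hR := hR) hr hfix χ
  -- Freshness makes `r` fix `χ`, so the same formula is compared on both sides.
  rw [rename_eq_self fun p hp => if_neg (hQχ p hp),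
    ← hχ Bool (twoState n φ.prop _ hR) false true (by simp [twoState]) hne rfl,
    ← hχ Bool (twoState n φ.prop Q hQ) false true (by simp [twoState]) hne rfl,
    twoState_consis, twoState_consis, hcard, Set.encard_singleton] at key
  have : φ.prop.card ≤ 1 := by exact_mod_cast key.2 le_rfl
  omega

end AwarenessStructure

end Awareness

theorem mainTheorem2 (n : ℕ) (i : Fin n) (φ : Awareness.Formula n)
    (hφ : (φ.prop : Set Awareness.Atom) ⊆ Awareness.realAtoms) :
    (φ.prop.card = 0 →
      ∀ (S : Type) [Finite S] (M : Awareness.AwarenessStructure n S) (t : S),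
        (M.Consis φ i t ↔ True)) ∧
    (φ.prop.card = 1 →
      ∀ (S : Type) [Finite S] (M : Awareness.AwarenessStructure n S) (s t : S) (x : ℕ),
        ¬ ((φ.prop : Set Awareness.Atom) ⊆ M.A i s) → M.K i s t →
        (M.Consis φ i t ↔
          M.Sat (Awareness.Formula.ex x (.neg (.aware i (.var x)))) t)) ∧
    (1 < φ.prop.card →
      ¬ ∃ χ : Awareness.Formula n,
        ∀ (S : Type) [Finite S] (M : Awareness.AwarenessStructure n S) (s t : S),
          (φ.prop : Set Awareness.Atom) ⊆ M.L s →
          ¬ ((φ.prop : Set Awareness.Atom) ⊆ M.A i s) → M.K i s t →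
          (M.Consis φ i t ↔ M.Sat χ t)) := by
  refine ⟨fun h S _ M t => iff_true_intro ?_, fun h S _ M s t x hA hK => ?_, fun h =>
    Awareness.AwarenessStructure.not_exists_consis_iff_sat i h⟩
  · simp [Awareness.AwarenessStructure.Consis, Finset.card_eq_zero.1 h]
  · rw [Awareness.AwarenessStructure.sat_ex_not_aware,
      M.consis_iff_of_card_eq_one h hA hK]
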